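/- Let $p,p_{11},p_{21},p_{31}\in\mathbb C[s]$ have no common factor, with $p\neq 0$, and let $\mathcal P(s)=(p_1(s),p_2(s),p_3(s))$, $p_j=p_{j1}/p$, be the non-constant rational parametrization of a space curve $\mathcal C\subset\mathbb C^3$ (for instance, a real one). Assume that the projective closure $\mathcal C^*\subset\mathbb P^3$ of $\mathcal C$, in coordinates $(x_1:x_2:x_3:x_4)$ with hyperplane at infinity $x_4=0$, contains no point $(0:a:b:0)$ with $a\ne 0$ or $b\neq 0$. Let $\deg(p_1)$ be the degree of the rational function $p_1$, that is, the maximum of the degrees of its numerator and its denominator in lowest terms. Let $\ell(t)\in\mathbb C\ll t\gg=\bigcup_{n\ge1}\mathbb C((t^{1/n}))$ be a Puiseux series with $p(\ell(t))-t\,p_{11}(\ell(t))=0$. Let $N$ be its ramification index (the least $N\geq 1$ with $\ell\in\mathbb C((t^{1/N}))$), and write $\ell(t)=\sum_{i\ge 0}c_i\,t^{e_0+i/N}$ with $e_0=\min\{0,\operatorname{ord}(\ell)\}$; the summands $c_i\,t^{e_0+i/N}$, $i=0,1,2,\dots$, including those with $c_i=0$, are called the terms of $\ell$. Then $p(\ell)\ne0$,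 so that the branch series $r_j(z)=p_j(\ell(z^{-1}))$, $j=2,3$, are defined, and all their terms with non-negative exponent in $z$ are determined by the first $2\deg(p_1)+1$ terms of $\ell$: if $\tilde\ell$ is any Puiseux series that has the same coefficients as $\ell$ at all exponents $e\le e_0+2\deg(p_1)/N$ (for example, the sum of the first $2\deg(p_1)+1$ terms of $\ell$), then $p(\tilde\ell)\neq 0$ and, for $j=2,3$ and all rational $e\geq 0$, the coefficient of $z^e$ in $p_j(\tilde\ell(z^{-1}))$ equals the coefficient of $z^e$ in $r_j(z)$. -/

import Mathlib

open Polynomial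

noncomputable section

namespace SpaceCurve

/-! ### Puiseux series

The field of formal Puiseux series `⋃ N ≥ 1, ℂ((t^(1/N)))` consists of the Hahn series in `t` with
rational exponents all of whose exponents lie in `(1/N)ℤ` for some `N ≥ 1`; field operations are
those of `HahnSeries ℚ ℂ`. -/

/-- `φ` belongs to `ℂ((t^(1/N)))`, where `N ≥ 1`. -/
def IsLaurentInRoot (N : ℕ) (φ : HahnSeries ℚ ℂ) : Prop :=
  0 < N ∧ ∀ e ∈ φ.support, ∃ k : ℤ, e = (k : ℚ) / (N : ℚ)

/-- `φ` is a formal Puiseux series. -/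
def IsPuiseux (φ : HahnSeries ℚ ℂ) : Prop :=
  ∃ N : ℕ, IsLaurentInRoot N φ

/-- The ramification index of a Puiseux series: the least `N ≥ 1` with `φ ∈ ℂ((t^(1/N)))`. -/
def ramificationIndex (φ : HahnSeries ℚ ℂ) : ℕ :=
  sInf {N : ℕ | IsLaurentInRoot N φ}

/-- The terms of `φ` of ramification index `N`, written out with all exponents in `(1/N)ℤ`, are
numbered from the exponent `min 0 (ord φ)`: this is the exponent of term number `i`
(`i = 0, 1, 2, …`). Zero coefficients count as terms. -/
def termExponent (φ : HahnSeries ℚ ℂ) (i : ℕ) : ℚ :=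
  min 0 φ.order + (i : ℚ) / (ramificationIndex φ : ℚ)

/-- `ψ` starts with the first `M` terms of `φ`: the two series have the same coefficients at every
exponent up to that of the last of these terms. -/
def StartsWithFirstTerms (M : ℕ) (φ ψ : HahnSeries ℚ ℂ) : Prop :=
  ∀ i < M, ∀ e ≤ termExponent φ i, ψ.coeff e = φ.coeff e

/-! ### Rational parametrizations `P = (q 0 / p, q 1 / p, q 2 / p)` -/

/-- The `j`-th component, a rational function. -/
def component (p : ℂ[X]) (q : Fin 3 → ℂ[X]) (j : Fin 3) : RatFunc ℂ :=
  algebraMap ℂ[X] (RatFunc ℂ) (q j) / algebraMap ℂ[X] (RatFunc ℂ) p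

/-- The degree of a rational function: the larger one of the degrees of the numerator and the
denominator in lowest terms. -/
def ratDegree (f : RatFunc ℂ) : ℕ :=
  max f.num.natDegree f.denom.natDegree

/-- The points of affine space reached by the parametrization. -/
def image (p : ℂ[X]) (q : Fin 3 → ℂ[X]) : Set (Fin 3 → ℂ) :=
  {x | ∃ s : ℂ, p.eval s ≠ 0 ∧ ∀ j, x j = (q j).eval s / p.eval s}

/-- The projective closure of `S ⊆ ℂ³` (embedded by `x ↦ (x : 1)`), as a set of vectors of
homogeneous coordinates: the common zeros of all homogeneous polynomials vanishing on `S`. -/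
def projectiveClosure (S : Set (Fin 3 → ℂ)) : Set (Fin 4 → ℂ) :=
  {x | x ≠ 0 ∧ ∀ (n : ℕ) (F : MvPolynomial (Fin 4) ℂ), F.IsHomogeneous n →
    (∀ y ∈ S, MvPolynomial.eval ![y 0, y 1, y 2, 1] F = 0) → MvPolynomial.eval x F = 0}

/-- `ℓ` is a Puiseux solution of `p(s) - t q₀(s) = 0`. -/
def IsPuiseuxSolution (p : ℂ[X]) (q : Fin 3 → ℂ[X]) (l : HahnSeries ℚ ℂ) : Prop :=
  IsPuiseux l ∧ aeval l p - HahnSeries.single (1 : ℚ) (1 : ℂ) * aeval l (q 0) = 0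

/-- The `j`-th component of the parametrization evaluated at the series `ℓ`, a series in `t`. -/
def evalComponent (p : ℂ[X]) (q : Fin 3 → ℂ[X]) (j : Fin 3) (l : HahnSeries ℚ ℂ) :
    HahnSeries ℚ ℂ :=
  aeval l (q j) / aeval l p

/-- The coefficient of `z ^ e` in the branch series `r_j(z) = P_j(ℓ(z⁻¹))`, that is, the coefficient
of `t ^ (-e)` in `P_j(ℓ(t))`. -/
def branchCoeff (p : ℂ[X]) (q : Fin 3 → ℂ[X]) (j : Fin 3) (l : HahnSeries ℚ ℂ) (e : ℚ) : ℂ :=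
  (evalComponent p q j l).coeff (-e)

end SpaceCurve

end

/-! Let d be the larger of deg p and deg q₀. The hypothesis at infinity is used twice. At a finite
parameter it makes p and q₀ coprime (`isCoprime_of_infinity`), so that d = deg(p₁); at s = ∞ it
gives deg qⱼ ≤ d (`natDegree_le_of_infinity`). Put c = -min(0, ord ℓ). The equation p(ℓ) = t q₀(ℓ)
and coprimality bound the order of p(ℓ) by 1 - cd (`exists_val_aeval_solution`). Changing ℓ beyond
the exponent 2 - c changes polynomials of degree ≤ d only beyond 2 - cd, hence the quotients qⱼ/p
only at positive exponents of t (`val_sub_pos_of_solution`). It remains to turn the length 2 into a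
number of terms. The N conjugates of ℓ are distinct roots of p - t q₀, which has degree at most d in
s, so N ≤ d (`ramificationIndex_le`), and 2d steps of size 1/N cover a length of at least 2. -/

noncomputable section

namespace SpaceCurve

/-! ### Valuation estimates for polynomials in a Hahn series -/

/-- The order of a series, with value `⊤` at `0`. -/
abbrev val : AddValuation (HahnSeries ℚ ℂ) (WithTop ℚ) := HahnSeries.addVal ℚ ℂ

lemma val_add_le_mul {x y : HahnSeries ℚ ℂ} {a b : ℚ} (hx : (a : WithTop ℚ) ≤ val x)
    (hy : (b : WithTop ℚ) ≤ val y) : ((a + b : ℚ) : WithTop ℚ) ≤ val (x * y) := by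
  rw [AddValuation.map_mul, WithTop.coe_add]
  exact add_le_add hx hy

lemma val_add_lt_mul {x y : HahnSeries ℚ ℂ} {a b : ℚ} (hx : (a : WithTop ℚ) ≤ val x)
    (hy : (b : WithTop ℚ) < val y) : ((a + b : ℚ) : WithTop ℚ) < val (x * y) := by
  rw [AddValuation.map_mul, WithTop.coe_add]
  exact WithTop.add_lt_add_of_le_of_lt WithTop.coe_ne_top hx hy

lemma le_val_pow {x : HahnSeries ℚ ℂ} {a : ℚ} (hx : (a : WithTop ℚ) ≤ val x) (n : ℕ) :
    ((n * a : ℚ) : WithTop ℚ) ≤ val (x ^ n) := by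
  induction n with
  | zero => simp
  | succ n ih =>
    rw [pow_succ]
    convert val_add_le_mul ih hx using 2
    push_cast
    ring

lemma algebraMap_eq_C (a : ℂ) : algebraMap ℂ (HahnSeries ℚ ℂ) a = HahnSeries.C a :=
  HahnSeries.ofPowerSeries_C a

lemma aeval_eq_sum (x : HahnSeries ℚ ℂ) (f : ℂ[X]) :
    aeval x f = ∑ i ∈ Finset.range (f.natDegree + 1),
      algebraMap ℂ (HahnSeries ℚ ℂ) (f.coeff i) * x ^ i := by
  rw [aeval_def, eval₂_eq_sum_range]

lemma val_algebraMap {a : ℂ} (ha : a ≠ 0) : val (algebraMap ℂ (HahnSeries ℚ ℂ) a) = 0 := by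
  rw [algebraMap_eq_C, HahnSeries.C_apply, HahnSeries.addVal_apply]
  exact HahnSeries.orderTop_single ha

lemma val_algebraMap_nonneg (a : ℂ) :
    ((0 : ℚ) : WithTop ℚ) ≤ val (algebraMap ℂ (HahnSeries ℚ ℂ) a) := by
  rcases eq_or_ne a 0 with rfl | ha
  · simp
  · exact (val_algebraMap ha).ge

lemma neg_mul_le_val_aeval {x : HahnSeries ℚ ℂ} {c : ℚ} (hc : 0 ≤ c)
    (hx : ((-c : ℚ) : WithTop ℚ) ≤ val x) {f : ℂ[X]} {D : ℕ} (hf : f.natDegree ≤ D) :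
    ((-(c * D) : ℚ) : WithTop ℚ) ≤ val (aeval x f) := by
  rw [aeval_eq_sum]
  refine AddValuation.map_le_sum _ fun i hi => ?_
  refine le_trans ?_ (val_add_le_mul (val_algebraMap_nonneg _) (le_val_pow hx i))
  rw [WithTop.coe_le_coe]
  have : (i : ℚ) ≤ D := by
    have := Finset.mem_range.1 hi
    exact_mod_cast (by omega : i ≤ D)
  nlinarith

/-- Precision is measured relative to the scale t^(-c): the gap b survives each multiplication,
while the scale drops by c. -/
lemma lt_val_pow_sub_pow {x y : HahnSeries ℚ ℂ} {b c : ℚ}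
    (hx : ((-c : ℚ) : WithTop ℚ) ≤ val x) (hy : ((-c : ℚ) : WithTop ℚ) ≤ val y)
    (hxy : ((b - c : ℚ) : WithTop ℚ) < val (y - x)) (n : ℕ) :
    ((b - c * n : ℚ) : WithTop ℚ) < val (y ^ n - x ^ n) := by
  induction n with
  | zero => simp
  | succ n ih =>
    rw [show y ^ (n + 1) - x ^ (n + 1) = y ^ n * (y - x) + x * (y ^ n - x ^ n) by ring]
    refine AddValuation.map_lt_add _ ?_ ?_
    · convert val_add_lt_mul (le_val_pow hy n) hxy using 2
      push_cast
      ring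
    · convert val_add_lt_mul hx ih using 2
      push_cast
      ring

lemma lt_val_aeval_sub_aeval {x y : HahnSeries ℚ ℂ} {b c : ℚ} (hc : 0 ≤ c)
    (hx : ((-c : ℚ) : WithTop ℚ) ≤ val x) (hy : ((-c : ℚ) : WithTop ℚ) ≤ val y)
    (hxy : ((b - c : ℚ) : WithTop ℚ) < val (y - x)) {f : ℂ[X]} {D : ℕ} (hf : f.natDegree ≤ D) :
    ((b - c * D : ℚ) : WithTop ℚ) < val (aeval y f - aeval x f) := by
  rw [aeval_eq_sum, aeval_eq_sum, ← Finset.sum_sub_distrib]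
  refine AddValuation.map_lt_sum' _ (WithTop.coe_lt_top _) fun i hi => ?_
  rw [← mul_sub]
  refine lt_of_le_of_lt ?_
    (val_add_lt_mul (val_algebraMap_nonneg _) (lt_val_pow_sub_pow hx hy hxy i))
  rw [WithTop.coe_le_coe]
  have : (i : ℚ) ≤ D := by
    have := Finset.mem_range.1 hi
    exact_mod_cast (by omega : i ≤ D)
  nlinarith

/-- At a series with a pole, the leading monomial of the polynomial has strictly the smallest order.
-/
lemma val_aeval_of_neg {x : HahnSeries ℚ ℂ} {r : ℚ} (hr : 0 < r)
    (hx : val x = ((-r : ℚ) : WithTop ℚ)) {f : ℂ[X]} (hf : f ≠ 0) :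
    val (aeval x f) = ((-(r * f.natDegree) : ℚ) : WithTop ℚ) := by
  have hpow : ∀ n : ℕ, val (x ^ n) = ((-(r * n) : ℚ) : WithTop ℚ) := by
    intro n
    induction n with
    | zero => simp
    | succ n ih =>
      rw [pow_succ, AddValuation.map_mul, ih, hx, ← WithTop.coe_add]
      congr 1
      push_cast
      ring
  have hlead : val (algebraMap ℂ (HahnSeries ℚ ℂ) f.leadingCoeff * x ^ f.natDegree) =
      ((-(r * f.natDegree) : ℚ) : WithTop ℚ) := by
    rw [AddValuation.map_mul, val_algebraMap (leadingCoeff_ne_zero.2 hf),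
      zero_add, hpow]
  rw [aeval_eq_sum, Finset.sum_range_succ, ← hlead]
  refine AddValuation.map_add_eq_of_lt_right _ ?_
  rw [coeff_natDegree]
  rw [hlead]
  refine AddValuation.map_lt_sum' _ (WithTop.coe_lt_top _) fun i hi => ?_
  refine lt_of_lt_of_le ?_ (val_add_le_mul (val_algebraMap_nonneg _) (hpow i).ge)
  rw [WithTop.coe_lt_coe]
  have : (i : ℚ) < f.natDegree := by exact_mod_cast Finset.mem_range.1 hi
  nlinarith

lemma val_single_one : val (HahnSeries.single (1 : ℚ) (1 : ℂ)) = ((1 : ℚ) : WithTop ℚ) := by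
  rw [HahnSeries.addVal_apply]
  exact HahnSeries.orderTop_single one_ne_zero

lemma min_order_le_val (x : HahnSeries ℚ ℂ) :
    ((min 0 x.order : ℚ) : WithTop ℚ) ≤ val x := by
  rcases eq_or_ne x 0 with rfl | hx
  · simp
  · rw [HahnSeries.addVal_apply_of_ne hx, WithTop.coe_le_coe]
    exact min_le_right _ _

/-! ### Solutions of p(s) = t a(s) and their perturbations -/

lemma aeval_ne_zero_of_solution {p a : ℂ[X]} (hcop : IsCoprime p a) {x : HahnSeries ℚ ℂ}
    (hx : aeval x p = HahnSeries.single (1 : ℚ) (1 : ℂ) * aeval x a) : aeval x p ≠ 0 := by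
  intro h0
  have ha : aeval x a = 0 := by
    rw [h0] at hx
    refine (mul_eq_zero.1 hx.symm).resolve_left ?_
    simp
  obtain ⟨u, w, huw⟩ := hcop
  have := congrArg (aeval x) huw
  simp [h0, ha] at this

/-- The order of the denominator along a solution of `p(s) = t a(s)`. -/
lemma exists_val_aeval_solution {p a : ℂ[X]} (hcop : IsCoprime p a) {x : HahnSeries ℚ ℂ}
    (hx : aeval x p = HahnSeries.single (1 : ℚ) (1 : ℂ) * aeval x a) :
    ∃ w : ℚ, val (aeval x p) = (w : WithTop ℚ) ∧
      w ≤ 1 + min 0 x.order * (max p.natDegree a.natDegree : ℕ) := by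
  have hpx := aeval_ne_zero_of_solution hcop hx
  have hax : aeval x a ≠ 0 := by
    rintro h
    rw [h, mul_zero] at hx
    exact hpx hx
  have hval := congrArg val hx
  rw [AddValuation.map_mul, val_single_one] at hval
  rcases le_or_gt 0 x.order with h0 | h0
  · rw [min_eq_left h0]
    refine ⟨1, ?_, by simp⟩
    have hx0 := min_order_le_val x
    rw [min_eq_left h0] at hx0
    have hnonneg : ∀ f : ℂ[X], ((0 : ℚ) : WithTop ℚ) ≤ val (aeval x f) := fun f => by
      simpa using neg_mul_le_val_aeval le_rfl (by simpa using hx0) (le_refl f.natDegree)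
    suffices h : val (aeval x a) = 0 by rw [hval, h, add_zero]
    refine le_antisymm ?_ (hnonneg a)
    -- Otherwise both summands of the Bézout identity would have positive order, but their sum is 1.
    by_contra! hlt
    obtain ⟨u, w, huw⟩ := hcop
    have h1 := congrArg (aeval x) huw
    rw [map_add, map_mul, map_mul, map_one] at h1
    have h2 : ((0 : ℚ) : WithTop ℚ) < val (1 : HahnSeries ℚ ℂ) := by
      rw [← h1]
      refine AddValuation.map_lt_add _ ?_ ?_
      · refine lt_of_lt_of_le ?_ (val_add_le_mul (hnonneg u) (b := 1) ?_)
        · rw [WithTop.coe_lt_coe]; norm_num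
        · rw [hval]
          exact le_add_of_nonneg_right (hnonneg a)
      · simpa using val_add_lt_mul (hnonneg w) (b := 0) hlt
    simp at h2
  · have hx0 : x ≠ 0 := by rintro rfl; simp at h0
    have hr : 0 < -x.order := by linarith
    have hvx : val x = ((-(-x.order) : ℚ) : WithTop ℚ) := by
      rw [neg_neg]; exact HahnSeries.addVal_apply_of_ne hx0
    have hp0 : p ≠ 0 := by rintro rfl; simp at hpx
    have ha0 : a ≠ 0 := by rintro rfl; simp at hax
    rw [val_aeval_of_neg hr hvx hp0, val_aeval_of_neg hr hvx ha0, ← WithTop.coe_add,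
      WithTop.coe_inj] at hval
    refine ⟨_, val_aeval_of_neg hr hvx hp0, ?_⟩
    -- With r = -ord x, comparing orders gives r (deg a - deg p) = 1.
    have hdeg : p.natDegree ≤ a.natDegree := by
      by_contra! h
      have : (a.natDegree : ℚ) < p.natDegree := by exact_mod_cast h
      nlinarith
    rw [min_eq_right h0.le, max_eq_right hdeg]
    linarith

theorem val_sub_pos_of_solution {p a f : ℂ[X]} (hcop : IsCoprime p a)
    (hf : f.natDegree ≤ max p.natDegree a.natDegree) {x y : HahnSeries ℚ ℂ}
    (hx : aeval x p = HahnSeries.single (1 : ℚ) (1 : ℂ) * aeval x a)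
    (hxy : ((min 0 x.order + 2 : ℚ) : WithTop ℚ) < val (y - x)) :
    aeval y p ≠ 0 ∧
      ((0 : ℚ) : WithTop ℚ) < val (aeval y f / aeval y p - aeval x f / aeval x p) := by
  have hpx := aeval_ne_zero_of_solution hcop hx
  obtain ⟨w, hw, hw2⟩ := exists_val_aeval_solution hcop hx
  have hvx := min_order_le_val x
  set d := max p.natDegree a.natDegree with hd
  obtain ⟨c, hc⟩ : ∃ c : ℚ, min 0 x.order = -c := ⟨-min 0 x.order, by ring⟩
  have hc0 : 0 ≤ c := by have := min_le_left 0 x.order; linarith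
  rw [hc] at hvx hxy hw2
  have hxy' : ((2 - c : ℚ) : WithTop ℚ) < val (y - x) := by
    rwa [show (2 - c : ℚ) = -c + 2 by ring]
  have hvy : ((-c : ℚ) : WithTop ℚ) ≤ val y := by
    rw [← sub_add_cancel y x]
    refine AddValuation.map_le_add _ (le_trans ?_ hxy.le) hvx
    rw [WithTop.coe_le_coe]; linarith
  have hpd : (p.natDegree : ℚ) ≤ d := by exact_mod_cast le_max_left _ _
  have hdp := lt_val_aeval_sub_aeval hc0 hvx hvy hxy' (le_refl p.natDegree)
  have hdf := lt_val_aeval_sub_aeval hc0 hvx hvy hxy' hf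
  have hvf := neg_mul_le_val_aeval hc0 hvx hf
  -- The change in p has order above 2 - cd, while w ≤ 1 - cd, so the order of p is unaffected.
  have hvpy : val (aeval y p) = (w : WithTop ℚ) := by
    rw [← hw]
    refine AddValuation.map_eq_of_lt_sub _ (lt_of_le_of_lt ?_ hdp)
    rw [hw, WithTop.coe_le_coe]
    nlinarith
  have hpy : aeval y p ≠ 0 := by
    intro h
    rw [h, AddValuation.map_zero] at hvpy
    exact WithTop.top_ne_coe hvpy
  refine ⟨hpy, ?_⟩
  -- This is the numerator over the common denominator p(x)p(y), of order 2w. The second product has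
  -- order above 2 - 2cd ≥ 2w, which is what requires the constant 2.
  have hnum : ((w + w : ℚ) : WithTop ℚ) <
      val (aeval x p * (aeval y f - aeval x f) - aeval x f * (aeval y p - aeval x p)) := by
    rw [sub_eq_add_neg]
    refine AddValuation.map_lt_add _ ?_ ?_
    · refine lt_of_le_of_lt ?_ (val_add_lt_mul hw.ge hdf)
      rw [WithTop.coe_le_coe]
      nlinarith
    · rw [AddValuation.map_neg]
      refine lt_of_le_of_lt ?_ (val_add_lt_mul hvf hdp)
      rw [WithTop.coe_le_coe]
      nlinarith
  by_contra! hle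
  have hmul : (aeval y f / aeval y p - aeval x f / aeval x p) * (aeval x p * aeval y p) =
      aeval x p * (aeval y f - aeval x f) - aeval x f * (aeval y p - aeval x p) := by
    field_simp
    ring
  rw [← hmul, AddValuation.map_mul, AddValuation.map_mul, hw, hvpy, ← WithTop.coe_add] at hnum
  have := add_le_add_left hle ((w + w : ℚ) : WithTop ℚ)
  rw [← WithTop.coe_add, zero_add] at this
  exact absurd hnum (not_lt.2 this)

/-! ### The ramification index is at most the degree -/

/-- The character `e ↦ exp (2 π i k e)` of `ℚ`, which is trivial on `ℤ`. -/
def character (k : ℤ) (e : ℚ) : ℂ := Complex.exp (2 * Real.pi * Complex.I * (k * e : ℚ))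

lemma character_add (k : ℤ) (e f : ℚ) :
    character k (e + f) = character k e * character k f := by
  rw [character, character, character, ← Complex.exp_add]
  push_cast
  ring_nf

lemma character_add_left (k m : ℤ) (e : ℚ) :
    character (k + m) e = character k e * character m e := by
  rw [character, character, character, ← Complex.exp_add]
  push_cast
  ring_nf

lemma character_ne_zero (k : ℤ) (e : ℚ) : character k e ≠ 0 := Complex.exp_ne_zero _

lemma character_eq_one_iff {k : ℤ} {e : ℚ} : character k e = 1 ↔ ∃ n : ℤ, k * e = n := by
  rw [character, Complex.exp_eq_one_iff]
  refine exists_congr fun n => ?_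
  rw [mul_comm, mul_left_inj' (by simp [Real.pi_ne_zero])]
  norm_cast

/-- The conjugation `t ^ e ↦ exp (2 π i k e) t ^ e` of series with rational exponents. -/
def conjugate (k : ℤ) : HahnSeries ℚ ℂ →+* HahnSeries ℚ ℂ where
  toFun x :=
    { coeff := fun e => character k e * x.coeff e
      isPWO_support' := x.isPWO_support.mono fun e he => right_ne_zero_of_mul he }
  map_zero' := by ext; simp
  map_add' x y := by ext; simp [mul_add]
  map_one' := by
    ext e
    rcases eq_or_ne e 0 with rfl | he
    · simp [character]
    · simp [HahnSeries.coeff_one, he]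
  map_mul' x y := by
    ext e
    simp only [HahnSeries.coeff_mul, Finset.mul_sum]
    refine Finset.sum_congr ?_ fun ij hij => ?_
    · ext ij
      simp [character_ne_zero]
    · rw [← (Finset.mem_antidiagonal.1 hij).2.2, character_add]
      ring

@[simp] lemma coeff_conjugate (k : ℤ) (x : HahnSeries ℚ ℂ) (e : ℚ) :
    (conjugate k x).coeff e = character k e * x.coeff e := rfl

lemma conjugate_single_intCast (k n : ℤ) (a : ℂ) :
    conjugate k (HahnSeries.single (n : ℚ) a) = HahnSeries.single (n : ℚ) a := by
  ext e
  rw [coeff_conjugate]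
  rcases eq_or_ne e n with rfl | he
  · rw [character_eq_one_iff.2 ⟨k * n, by push_cast; rfl⟩, one_mul]
  · rw [HahnSeries.coeff_single_of_ne he, mul_zero]

lemma conjugate_aeval (k : ℤ) (x : HahnSeries ℚ ℂ) (f : ℂ[X]) :
    conjugate k (aeval x f) = aeval (conjugate k x) f := by
  rw [aeval_def, hom_eval₂, aeval_def]
  congr 1
  ext a : 1
  rw [RingHom.comp_apply, algebraMap_eq_C, HahnSeries.C_apply]
  exact_mod_cast conjugate_single_intCast k 0 a

lemma isLaurentInRoot_of_conjugate_eq {k : ℕ} (hk : 0 < k) {x : HahnSeries ℚ ℂ}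
    (hx : conjugate k x = x) : IsLaurentInRoot k x := by
  refine ⟨hk, fun e he => ?_⟩
  have h1 : character k e * x.coeff e = x.coeff e := by rw [← coeff_conjugate, hx]
  obtain ⟨n, hn⟩ := character_eq_one_iff.1 ((mul_eq_right₀ he).1 h1)
  refine ⟨n, ?_⟩
  have : (k : ℚ) ≠ 0 := by positivity
  rw [eq_div_iff this, ← hn, mul_comm]
  rfl

/-- If the i-th and j-th conjugates agree, i < j, then x is fixed by the (j - i)-th conjugation, so
its exponents lie in ℤ/(j - i), against minimality of the ramification index. -/
lemma conjugate_injOn {x : HahnSeries ℚ ℂ} :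
    Set.InjOn (fun i : ℕ => conjugate i x) (Finset.range (ramificationIndex x)) := by
  have key : ∀ i j : ℕ, i < j → j < ramificationIndex x → conjugate i x ≠ conjugate j x := by
    intro i j hij hj h
    refine Nat.notMem_of_lt_sInf (lt_of_le_of_lt (Nat.sub_le j i) hj)
      (isLaurentInRoot_of_conjugate_eq (Nat.sub_pos_of_lt hij) ?_)
    ext e
    have he := congrArg (fun y => y.coeff e) h
    simp only [coeff_conjugate] at he ⊢
    rw [show (j : ℤ) = i + ((j - i : ℕ) : ℤ) by omega, character_add_left, mul_assoc] at he
    exact (mul_left_cancel₀ (character_ne_zero _ _) he).symm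
  intro i hi j hj h
  rcases lt_trichotomy i j with hij | hij | hij
  · exact absurd h (key i j hij (by simpa using hj))
  · exact hij
  · exact absurd h.symm (key j i hij (by simpa using hi))

lemma ramificationIndex_le {p a : ℂ[X]} (hp : p ≠ 0) {x : HahnSeries ℚ ℂ}
    (hx : aeval x p - HahnSeries.single (1 : ℚ) (1 : ℂ) * aeval x a = 0) :
    ramificationIndex x ≤ max p.natDegree a.natDegree := by
  classical
  set A := algebraMap ℂ (HahnSeries ℚ ℂ) with hA
  set F : (HahnSeries ℚ ℂ)[X] :=
    p.map A - C (HahnSeries.single (1 : ℚ) (1 : ℂ)) * a.map A with hF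
  have hF0 : F ≠ 0 := by
    intro h
    refine hp (Polynomial.ext fun n => ?_)
    -- The part of F constant in t is p.
    have h1 := congrArg (fun y => y.coeff 0) (congrArg (fun G => coeff G n) h)
    simpa [hF, hA, algebraMap_eq_C, HahnSeries.C_apply, HahnSeries.single_mul_single,
      HahnSeries.coeff_single] using h1
  have hdeg : F.natDegree ≤ max p.natDegree a.natDegree := by
    refine (natDegree_sub_le _ _).trans (max_le_max natDegree_map_le ?_)
    exact (natDegree_C_mul_le _ _).trans natDegree_map_le
  have hroot : ∀ k : ℤ, F.IsRoot (conjugate k x) := by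
    intro k
    have h1 := congrArg (conjugate k) hx
    rw [map_sub, map_mul, conjugate_aeval, conjugate_aeval, map_zero] at h1
    have h2 := conjugate_single_intCast k 1 1
    rw [Int.cast_one] at h2
    rw [h2] at h1
    rw [IsRoot, hF, eval_sub, eval_mul, eval_C, eval_map_algebraMap, eval_map_algebraMap]
    exact h1
  rw [← Finset.card_range (ramificationIndex x), ← Finset.card_image_of_injOn conjugate_injOn]
  refine (card_le_degree_of_subset_roots ?_).trans hdeg
  intro y hy
  obtain ⟨i, -, rfl⟩ := Finset.mem_image.1 (Finset.mem_def.2 hy)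
  exact (mem_roots hF0).2 (hroot i)

/-! ### Points at infinity of the projective closure -/

lemma eval_smul_of_isHomogeneous {σ : Type*} [Fintype σ] {F : MvPolynomial σ ℂ} {n : ℕ}
    (hF : F.IsHomogeneous n) (c : ℂ) (x : σ → ℂ) :
    MvPolynomial.eval (c • x) F = c ^ n * MvPolynomial.eval x F := by
  rw [MvPolynomial.eval_eq', MvPolynomial.eval_eq', Finset.mul_sum]
  refine Finset.sum_congr rfl fun d hd => ?_
  have hdn : ∑ i, d i = n := by
    rw [← hF (MvPolynomial.mem_support_iff.1 hd), Finsupp.weight_apply,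
      Finsupp.sum_fintype _ _ (by simp)]
    simp
  simp only [Pi.smul_apply, smul_eq_mul, mul_pow, Finset.prod_mul_distrib,
    Finset.prod_pow_eq_pow_sum, hdn]
  ring

/-- A form vanishing on S pulls back along f to a polynomial in s that is zero wherever g is not,
hence identically zero; this also covers the zeros of g. -/
lemma mem_projectiveClosure_of_polynomial {S : Set (Fin 3 → ℂ)} (f : Fin 4 → ℂ[X]) {g : ℂ[X]}
    (hg : g ≠ 0)
    (hS : ∀ s, g.eval s ≠ 0 → ∃ y ∈ S, ∃ c : ℂ, (fun i => (f i).eval s) = c • ![y 0, y 1, y 2, 1])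
    {s : ℂ} (hs : (fun i => (f i).eval s) ≠ 0) :
    (fun i => (f i).eval s) ∈ projectiveClosure S := by
  refine ⟨hs, fun n F hF hFS => ?_⟩
  have heval : ∀ s, (MvPolynomial.aeval f F).eval s =
      MvPolynomial.eval (fun i => (f i).eval s) F := by
    intro s
    rw [← coe_evalRingHom, MvPolynomial.aeval_def, MvPolynomial.hom_eval₂, MvPolynomial.eval,
      MvPolynomial.coe_eval₂Hom]
    congr 1
    ext a
    simp
  have h0 : MvPolynomial.aeval f F * g = 0 := by
    refine Polynomial.funext fun s => ?_
    rw [eval_mul, eval_zero]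
    by_cases hgs : g.eval s = 0
    · rw [hgs, mul_zero]
    · obtain ⟨y, hy, c, hc⟩ := hS s hgs
      rw [heval, hc, eval_smul_of_isHomogeneous hF, hFS y hy, mul_zero, zero_mul]
  rw [← heval, (mul_eq_zero.1 h0).resolve_right hg, eval_zero]

lemma eval_mem_projectiveClosure {p : ℂ[X]} {q : Fin 3 → ℂ[X]} (hp : p ≠ 0) {s : ℂ}
    (hs : ![(q 0).eval s, (q 1).eval s, (q 2).eval s, p.eval s] ≠ 0) :
    ![(q 0).eval s, (q 1).eval s, (q 2).eval s, p.eval s] ∈ projectiveClosure (image p q) := by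
  have h : ∀ s, (fun i => (![q 0, q 1, q 2, p] i).eval s) =
      ![(q 0).eval s, (q 1).eval s, (q 2).eval s, p.eval s] := by
    intro s
    ext i
    fin_cases i <;> rfl
  rw [← h] at hs ⊢
  refine mem_projectiveClosure_of_polynomial _ hp (fun s hps => ?_) hs
  refine ⟨fun j => (q j).eval s / p.eval s, ⟨s, hps, fun _ => rfl⟩, p.eval s, ?_⟩
  rw [h]
  ext i
  fin_cases i <;> simp [mul_div_cancel₀ _ hps]

lemma eval_reflect {D : ℕ} {f : ℂ[X]} (hf : f.natDegree ≤ D) {s : ℂ} (hs : s ≠ 0) :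
    (reflect D f).eval s = s ^ D * f.eval s⁻¹ := by
  let _ := invertibleOfNonzero hs
  have := eval₂_reflect_mul_pow (RingHom.id ℂ) s⁻¹ D f hf
  simp only [invOf_eq_inv, inv_inv] at this
  change (reflect D f).eval s * s⁻¹ ^ D = f.eval s⁻¹ at this
  rw [← this, mul_comm, mul_assoc, ← mul_pow, inv_mul_cancel₀ hs, one_pow, mul_one]

/-- This is the point at the parameter s = ∞: substitute 1/s, clear denominators by s^D, and set s =
0. -/
lemma coeff_mem_projectiveClosure {p : ℂ[X]} {q : Fin 3 → ℂ[X]} (hp : p ≠ 0) {D : ℕ}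
    (hpD : p.natDegree ≤ D) (hqD : ∀ j, (q j).natDegree ≤ D)
    (hs : ![(q 0).coeff D, (q 1).coeff D, (q 2).coeff D, p.coeff D] ≠ 0) :
    ![(q 0).coeff D, (q 1).coeff D, (q 2).coeff D, p.coeff D] ∈ projectiveClosure (image p q) := by
  have h : (fun i => (![reflect D (q 0), reflect D (q 1), reflect D (q 2), reflect D p] i).eval 0) =
      ![(q 0).coeff D, (q 1).coeff D, (q 2).coeff D, p.coeff D] := by
    ext i
    fin_cases i <;> simp [← coeff_zero_eq_eval_zero, coeff_reflect, revAt_le]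
  rw [← h] at hs ⊢
  have hg : X * reflect D p ≠ 0 := mul_ne_zero X_ne_zero (by simpa using hp)
  refine mem_projectiveClosure_of_polynomial _ hg (fun s hgs => ?_) hs
  rw [eval_mul, eval_X] at hgs
  have hs0 := left_ne_zero_of_mul hgs
  have hps := right_ne_zero_of_mul hgs
  rw [eval_reflect hpD hs0] at hps
  have hps' := right_ne_zero_of_mul hps
  refine ⟨fun j => (q j).eval s⁻¹ / p.eval s⁻¹, ⟨s⁻¹, hps', fun _ => rfl⟩,
    s ^ D * p.eval s⁻¹, ?_⟩
  ext i
  fin_cases i <;> simp [eval_reflect, hpD, hqD, hs0, mul_assoc, mul_div_cancel₀ _ hps']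

lemma isCoprime_of_infinity
    {p : ℂ[X]} {q : Fin 3 → ℂ[X]} (hp : p ≠ 0)
    (hinfinity : ∀ a b : ℂ, (a ≠ 0 ∨ b ≠ 0) → ![0, a, b, 0] ∉ projectiveClosure (image p q))
    (hcoprime : ∀ d : ℂ[X], d ∣ p → (∀ j, d ∣ q j) → IsUnit d) : IsCoprime p (q 0) := by
  rw [isCoprime_iff_aeval_ne_zero_of_isAlgClosed ℂ ℂ]
  intro s
  by_contra! h
  simp only [coe_aeval_eq_eval] at h
  have hq : (q 1).eval s ≠ 0 ∨ (q 2).eval s ≠ 0 := by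
    by_contra! hq
    refine not_isUnit_X_sub_C s (hcoprime _ (dvd_iff_isRoot.2 h.1) fun j => dvd_iff_isRoot.2 ?_)
    fin_cases j
    exacts [h.2, hq.1, hq.2]
  refine hinfinity _ _ hq ?_
  have := eval_mem_projectiveClosure (q := q) hp (s := s)
  rw [h.1, h.2] at this
  refine this fun h0 => ?_
  exact hq.elim (fun h1 => h1 (congrFun h0 1)) fun h2 => h2 (congrFun h0 2)

lemma natDegree_le_of_infinity
    {p : ℂ[X]} {q : Fin 3 → ℂ[X]} (hp : p ≠ 0)
    (hinfinity : ∀ a b : ℂ, (a ≠ 0 ∨ b ≠ 0) → ![0, a, b, 0] ∉ projectiveClosure (image p q))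
    (j : Fin 3) :
    (q j).natDegree ≤ max p.natDegree (q 0).natDegree := by
  by_contra! hj
  -- If the bound fails, D exceeds deg p and deg q₀, so the point at s = ∞ is (0:a:b:0) with a or b
  -- a leading coefficient.
  set D := max (q 1).natDegree (q 2).natDegree with hD
  have hjD : max p.natDegree (q 0).natDegree < D := by
    fin_cases j
    · exact absurd hj (by simp)
    · exact hj.trans_le (le_max_left _ _)
    · exact hj.trans_le (le_max_right _ _)
  have hpD := (le_max_left _ _).trans_lt hjD
  have h0D := (le_max_right _ _).trans_lt hjD
  have hq : (q 1).coeff D ≠ 0 ∨ (q 2).coeff D ≠ 0 := by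
    have key : ∀ f : ℂ[X], D = f.natDegree → f.coeff D ≠ 0 := by
      rintro f hf
      rw [hf]
      refine leadingCoeff_ne_zero.2 ?_
      rintro rfl
      rw [natDegree_zero] at hf
      omega
    exact (max_choice (q 1).natDegree (q 2).natDegree).imp (key _) (key _)
  refine hinfinity _ _ hq ?_
  have := coeff_mem_projectiveClosure (q := q) hp hpD.le (fun j => by
    fin_cases j
    exacts [h0D.le, le_max_left _ _, le_max_right _ _])
  rw [coeff_eq_zero_of_natDegree_lt hpD, coeff_eq_zero_of_natDegree_lt h0D] at this
  refine this fun h0 => ?_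
  exact hq.elim (fun h1 => h1 (congrFun h0 1)) fun h2 => h2 (congrFun h0 2)

lemma ratDegree_component {p : ℂ[X]} {q : Fin 3 → ℂ[X]} {j : Fin 3} (hp : p ≠ 0)
    (hcop : IsCoprime p (q j)) :
    ratDegree (component p q j) = max p.natDegree (q j).natDegree := by
  have hg : IsUnit (gcd (q j) p) := (gcd_isUnit_iff _ _).2 hcop.symm
  have hdiv : ∀ f : ℂ[X], gcd (q j) p ∣ f → (f / gcd (q j) p).natDegree = f.natDegree := by
    rintro f ⟨h, hh⟩
    conv_lhs => rw [hh, mul_div_cancel_left₀ _ hg.ne_zero]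
    obtain ⟨u, hu, hgu⟩ := isUnit_iff.1 hg
    rw [hh, ← hgu, natDegree_C_mul_of_isUnit hu]
  have hlc : (p / gcd (q j) p).leadingCoeff⁻¹ ≠ 0 := by
    refine inv_ne_zero (leadingCoeff_ne_zero.2 fun h => hp ?_)
    rw [← EuclideanDomain.mul_div_cancel' hg.ne_zero (gcd_dvd_right (q j) p), h, mul_zero]
  rw [ratDegree, component, RatFunc.num_div, RatFunc.denom_div _ hp, natDegree_C_mul hlc,
    natDegree_C_mul hlc, hdiv _ (gcd_dvd_left _ _), hdiv _ (gcd_dvd_right _ _), max_comm]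

end SpaceCurve

end

/-! ### Counting the terms that suffice -/

theorem mainTheorem3 (p : Polynomial ℂ) (q : Fin 3 → Polynomial ℂ) (hp : p ≠ 0)
    (hcoprime : ∀ d : Polynomial ℂ, d ∣ p → (∀ j, d ∣ q j) → IsUnit d)
    (hnonconst : ∃ j, ∀ c : ℂ, SpaceCurve.component p q j ≠ RatFunc.C c)
    (hinfinity : ∀ a b : ℂ, (a ≠ 0 ∨ b ≠ 0) →
      ![0, a, b, 0] ∉ SpaceCurve.projectiveClosure (SpaceCurve.image p q))
    (l : HahnSeries ℚ ℂ) (hl : SpaceCurve.IsPuiseuxSolution p q l) :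
    Polynomial.aeval l p ≠ 0 ∧
    ∀ l' : HahnSeries ℚ ℂ, SpaceCurve.IsPuiseux l' →
      SpaceCurve.StartsWithFirstTerms
        (2 * SpaceCurve.ratDegree (SpaceCurve.component p q 0) + 1) l l' →
      Polynomial.aeval l' p ≠ 0 ∧
      ∀ j : Fin 3, j ≠ 0 → ∀ e : ℚ, 0 ≤ e →
        SpaceCurve.branchCoeff p q j l' e = SpaceCurve.branchCoeff p q j l e := by
  obtain ⟨hpl, heq⟩ := hl
  have hcop := SpaceCurve.isCoprime_of_infinity hp hinfinity hcoprime
  have hx := sub_eq_zero.1 heq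
  refine ⟨SpaceCurve.aeval_ne_zero_of_solution hcop hx, fun l' _ hstart => ?_⟩
  rw [SpaceCurve.ratDegree_component hp hcop] at hstart
  have hN : 0 < SpaceCurve.ramificationIndex l := (Nat.sInf_mem hpl).1
  have hNd := SpaceCurve.ramificationIndex_le hp heq
  set d := max p.natDegree (q 0).natDegree
  -- Terms are numbered from 0, so the last of 2d + 1 terms has index 2d; N ≤ d gives 2d/N ≥ 2.
  have hexp : min 0 l.order + 2 ≤ SpaceCurve.termExponent l (2 * d) := by
    have h1 : (0 : ℚ) < SpaceCurve.ramificationIndex l := by exact_mod_cast hN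
    have h2 : (SpaceCurve.ramificationIndex l : ℚ) ≤ d := by exact_mod_cast hNd
    rw [SpaceCurve.termExponent, add_le_add_iff_left, le_div_iff₀ h1]
    push_cast
    linarith
  have hδ : ((min 0 l.order + 2 : ℚ) : WithTop ℚ) < SpaceCurve.val (l' - l) := by
    by_contra! hle
    rw [HahnSeries.addVal_apply] at hle
    obtain ⟨g, hg⟩ := WithTop.ne_top_iff_exists.1 (ne_top_of_le_ne_top WithTop.coe_ne_top hle)
    rw [← hg, WithTop.coe_le_coe] at hle
    refine HahnSeries.coeff_orderTop_ne hg.symm ?_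
    rw [HahnSeries.coeff_sub, hstart (2 * d) (Nat.lt_succ_self _) g (hle.trans hexp), sub_self]
  have key := fun j => SpaceCurve.val_sub_pos_of_solution hcop
    (SpaceCurve.natDegree_le_of_infinity hp hinfinity j) hx hδ
  refine ⟨(key 0).1, fun j _ e he => ?_⟩
  rw [SpaceCurve.branchCoeff, SpaceCurve.branchCoeff, ← sub_eq_zero, ← HahnSeries.coeff_sub]
  -- The exponent e ≥ 0 of z is -e ≤ 0 in t, below the positive order of the difference.
  refine HahnSeries.coeff_eq_zero_of_lt_orderTop (lt_of_le_of_lt ?_ (key j).2)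
  rw [WithTop.coe_le_coe]
  linarith
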